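/- Work in the topos $\mathbf{cSet}$ of presheaves on the cartesian cube category $\square$ (objects: the cubes of dimension $n\in\mathbb N$; a morphism $m\to n$ is a function $\{1,\dots,n\}\to\{1,\dots,m\}\sqcup\{0,1\}$). In its internal language, "set" means cubical set and families are presheaves over categories of elements. $\mathbb I$ is the interval (the presheaf represented by the $1$-cube), with endpoints $0\neq 1$. The set $\mathrm{Cof}$ of cofibrations is the subobject of $\Omega$ generated by the equalities $(i=j)$ for $i,j:\mathbb I$, binary conjunctions and binary disjunctions. An *extension structure* on a set $X$ assigns to every $\alpha:\mathrm{Cof}$ and every partial element $x:[\alpha]\to X$ an element of $X$ that is equal to $x$ under $\alpha$. A set with an extension structure is called trivially fibrant. A *weak composition structure* on a line of sets $X:\mathbb I\to\mathrm{Set}$ assigns, to all $r:\mathbb I$, $\alpha:\mathrm{Cof}$, $t:[\alpha]\to(s:\mathbb I)\to X(s)$ and $b:X(r)$ with $t(r)=b$ under $\alpha$, first for every $s:\mathbb I$ an element $\mathsf{wcom}^{r\to s}(t,b):X(s)$ that is equal to $t(s)$ under $\alpha$, and second a path in $X(r)$ from $\mathsf{wcom}^{r\to r}(t,b)$ to $b$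 that is constantly $b$ under $\alpha$. These structures form a family $\mathsf{HasWCom}:\mathrm{Set}^{\mathbb I}\to\mathrm{Set}$. Since $(-)^{\mathbb I}$ has a right adjoint $(-)_{\mathbb I}$, a family $C$ over $A^{\mathbb I}$ induces a family $C_{\mathbb I}$ over $A$, whose elements over $a:y(J)\to A$ are the global elements of $(l:y(J)^{\mathbb I})\to C(a^{\mathbb I}(l))$; this gives the family $\mathsf{HasWCom}_{\mathbb I}:\mathrm{Set}\to\mathrm{Set}$ of fibrancy structures. A global family $B$ over $A$ is a *family of fibrant sets* if there is a global element of $(a:A)\to\mathsf{HasWCom}_{\mathbb I}(B(a))$. Assume given a global pseudo-reflexive graph $$A:\mathrm{Set},\qquad E_A:A\to A\to\mathrm{Set},\qquad R_A:(a:A)\,(a_e:E_A(a,a))\to\mathrm{Set}$$ and a global dependent pseudo-reflexive graph over it, $$B:A\to\mathrm{Set},\qquad E_B:E_A(a_1,a_2)\to B(a_1)\to B(a_2)\to\mathrm{Set},\qquad R_B:R_A(a,a_e)\to(b:B(a))\,(b_e:E_B(a_e,b,b))\to\mathrm{Set}.$$ Assume, globally, that: * ($A$ and $B$ have weak coercion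 structures) for every $a:\mathbb I\to A$ and $r,s:\mathbb I$ we are given $\mathsf{wcoe}_a^{r\to s}:E_A(a(r),a(s))$ and $\mathsf{wcoh}_a^r:R_A(a(r),\mathsf{wcoe}_a^{r\to r})$; and for every $a:\mathbb I\to A$, $b:(i:\mathbb I)\to B(a(i))$ and $r,s:\mathbb I$ we are given $\mathsf{wcoe}_b^{r\to s}:E_B(\mathsf{wcoe}_a^{r\to s},b(r),b(s))$ and $\mathsf{wcoh}_b^r:R_B(\mathsf{wcoh}_a^r,b(r),\mathsf{wcoe}_b^{r\to r})$; * ($B$ is homotopical) for every $a_e:E_A(a_1,a_2)$ and $b_1:B(a_1)$, the set $(b_2:B(a_2))\times E_B(a_e,b_1,b_2)$ is trivially fibrant, and for every $a_r:R_A(a,a_e)$ and $b:B(a)$, the set $(b_e:E_B(a_e,b,b))\times R_B(a_r,b,b_e)$ is trivially fibrant (global families of extension structures are given). Then $B$ is a family of fibrant sets. -/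

import Mathlib

open CategoryTheory Opposite

universe u

/-- The functor to types given by plain maps. -/
def typeFunctor {C : Type*} [Category C] (obj : C → Type u)
    (map : ∀ {X Y : C}, (X ⟶ Y) → obj X → obj Y) (map_id : ∀ X (x : obj X), map (𝟙 X) x = x)
    (map_comp : ∀ {X Y Z : C} (f : X ⟶ Y) (g : Y ⟶ Z) (x : obj X),
      map (f ≫ g) x = map g (map f x)) : C ⥤ Type u where
  obj := obj
  map f := TypeCat.ofHom (map f)
  map_id X := ConcreteCategory.hom_ext _ _ (map_id X)
  map_comp f g := ConcreteCategory.hom_ext _ _ (map_comp f g)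

theorem typeFunctor_map_id {C : Type*} [Category C] (F : C ⥤ Type u) {X : C} (x : F.obj X) :
    F.map (𝟙 X) x = x :=
  Functor.map_id_apply F X x

/-! ### The cartesian cube category and cubical sets -/

/-- Objects of the cartesian cube category: the `dim`-dimensional cubes. -/
structure Cube where
  dim : ℕ

namespace Cube

/-- Points of the interval over a cube: a dimension variable or one of the endpoints
(`false` is `0`, `true` is `1`). -/
abbrev Pt (m : Cube) : Type := Fin m.dim ⊕ Bool

/-- Substitution of interval points for dimension variables. -/
def subst {m n : Cube} (f : Fin n.dim → m.Pt) : n.Pt → m.Pt := Sum.elim f Sum.inr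

/-- The cartesian cube category: a morphism `m ⟶ n` gives a point of the interval over `m` for
each of the `n` dimension variables (faces, degeneracies, diagonals and permutations). -/
instance : Category Cube where
  Hom m n := Fin n.dim → m.Pt
  id _ := Sum.inl
  comp f g := fun i => subst f (g i)
  id_comp f := by
    funext i
    show subst Sum.inl (f i) = f i
    rcases f i with j | j <;> rfl
  comp_id _ := rfl
  assoc f g h := by
    funext i
    show subst (fun j => subst f (g j)) (h i) = subst f (subst g (h i))
    rcases h i with j | j <;> rfl

end Cube

/-- Cubical sets: presheaves over the cartesian cube category. -/
abbrev CSet := Cubeᵒᵖ ⥤ Type u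

/-- The interval, i.e. the presheaf represented by the 1-dimensional cube. -/
def II : CSet.{0} :=
  typeFunctor (fun m => m.unop.Pt) (fun f => Cube.subst f.unop)
    (fun m x => by rcases x with j | j <;> rfl)
    (fun f g x => by rcases x with j | j <;> rfl)

namespace II

/-- The endpoint `0`. -/
def zero (c : Cubeᵒᵖ) : II.obj c := (Sum.inr false : c.unop.Pt)

/-- The endpoint `1`. -/
def one (c : Cubeᵒᵖ) : II.obj c := (Sum.inr true : c.unop.Pt)

end II

/-! ### Cofibrations -/

/-- The truth value `(i = j)` over a cube: the sieve of morphisms along which `i` and `j`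
become equal. -/
def eqSieve {m : Cube} (i j : II.obj (op m)) : Sieve m where
  arrows _ f := II.map f.op i = II.map f.op j
  downward_closed {X Y f} h g := by
    show II.map (g ≫ f).op i = II.map (g ≫ f).op j
    have h' : II.map f.op i = II.map f.op j := h
    simp only [op_comp, Functor.map_comp_apply, h']

/-- Cofibrations are the truth values (sieves) generated by interval equalities, binary
conjunctions and binary disjunctions. (`⊤` is `0 = 0` and `⊥` is `0 = 1`.) -/
inductive IsCof {m : Cube} : Sieve m → Prop
  | eq (i j : II.obj (op m)) : IsCof (eqSieve i j)
  | and {α β : Sieve m} : IsCof α → IsCof β → IsCof (α ⊓ β)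
  | or {α β : Sieve m} : IsCof α → IsCof β → IsCof (α ⊔ β)

theorem IsCof.pullback {m n : Cube} (f : n ⟶ m) {α : Sieve m} (h : IsCof α) :
    IsCof (α.pullback f) := by
  induction h with
  | eq i j =>
    have : (eqSieve i j).pullback f = eqSieve (II.map f.op i) (II.map f.op j) := by
      ext k g
      show II.map (g ≫ f).op i = II.map (g ≫ f).op j ↔
        II.map g.op (II.map f.op i) = II.map g.op (II.map f.op j)
      simp only [op_comp, Functor.map_comp_apply]
    rw [this]
    exact IsCof.eq _ _
  | and _ _ h₁ h₂ =>
    rw [Sieve.pullback_inter]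
    exact IsCof.and h₁ h₂
  | @or α β _ _ h₁ h₂ =>
    have : (α ⊔ β).pullback f = α.pullback f ⊔ β.pullback f := by
      ext k g
      simp [Sieve.pullback_apply, Sieve.union_apply]
    rw [this]
    exact IsCof.or h₁ h₂

/-- The elements over a stage `c` of the cubical set `Cof` of cofibrations. -/
def Cof (c : Cubeᵒᵖ) : Type := {S : Sieve c.unop // IsCof S}

namespace Cof

/-- The cofibration `α` becomes true after restriction along `f`. -/
def Holds {c c' : Cubeᵒᵖ} (α : Cof c) (f : c ⟶ c') : Prop := α.1 f.unop

/-- Restriction of a cofibration. -/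
def res {c c' : Cubeᵒᵖ} (f : c ⟶ c') (α : Cof c) : Cof c' :=
  ⟨α.1.pullback f.unop, α.2.pullback f.unop⟩

theorem Holds.comp {c c' c'' : Cubeᵒᵖ} {α : Cof c} {f : c ⟶ c'} (h : α.Holds f)
    (g : c' ⟶ c'') : α.Holds (f ≫ g) :=
  α.1.downward_closed h g.unop

end Cof

/-! ### Families of cubical sets, i.e. internal dependent types -/

/-- A global family over the cubical set `Γ`: a presheaf over the category of elements
of `Γ`. -/
abbrev Fam (Γ : CSet.{u}) := Γ.Elements ⥤ Type u

/-- Global elements of the dependent product `(γ : Γ) → X γ`. -/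
abbrev Tm {Γ : CSet.{u}} (X : Fam Γ) : Type u := X.sections

namespace Fam

variable {Γ Δ : CSet.{u}}

/-- The family `δ ↦ X (σ δ)`. -/
abbrev sub (σ : Δ ⟶ Γ) (X : Fam Γ) : Fam Δ := CategoryOfElements.map σ ⋙ X

theorem map_id_heq (X : Fam Γ) {e : Γ.Elements} {γ : Γ.obj e.1} (h : Γ.map (𝟙 e.1) e.2 = γ)
    (x : X.obj e) :
    HEq (X.map (X := e) (Y := ⟨e.1, γ⟩) ⟨𝟙 e.1, h⟩ x) x := by
  have h' : e.2 = γ := (typeFunctor_map_id Γ e.2).symm.trans h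
  subst h'
  exact heq_of_eq (typeFunctor_map_id X (X := e) x)

theorem map_heq (X : Fam Γ) {e : Γ.Elements} {c : Cubeᵒᵖ} {γ γ' : Γ.obj c} (f : e.1 ⟶ c)
    (h : Γ.map f e.2 = γ) (h' : Γ.map f e.2 = γ') (x : X.obj e) :
    HEq (X.map (X := e) (Y := ⟨c, γ⟩) ⟨f, h⟩ x)
      (X.map (X := e) (Y := ⟨c, γ'⟩) ⟨f, h'⟩ x) := by
  have : γ = γ' := h.symm.trans h'
  subst this
  rfl

/-- Context extension: the cubical set of pairs `(γ : Γ) × X γ`. -/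
def extend (X : Fam Γ) : CSet.{u} :=
  typeFunctor (fun c => Σ γ : Γ.obj c, X.obj ⟨c, γ⟩)
    (fun {c c'} f z =>
      ⟨Γ.map f z.1, X.map (X := ⟨c, z.1⟩) (Y := ⟨c', Γ.map f z.1⟩) ⟨f, rfl⟩ z.2⟩)
    (fun c z => Sigma.ext (typeFunctor_map_id _ _) (map_id_heq X (e := ⟨c, z.1⟩) rfl z.2))
    (fun {c c' c''} f g z => by
      refine Sigma.ext (Functor.map_comp_apply _ _ _ _) ?_
      refine (map_heq X (e := ⟨c, z.1⟩) (f ≫ g) rfl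
        (Functor.map_comp_apply _ _ _ _) z.2).trans ?_
      exact heq_of_eq (Functor.map_comp_apply X (X := ⟨c, z.1⟩) (Y := ⟨c', Γ.map f z.1⟩)
        (Z := ⟨c'', Γ.map g (Γ.map f z.1)⟩) ⟨f, rfl⟩ ⟨g, rfl⟩ z.2))

theorem extend_map_eq (X : Fam Γ) {c c' : Cubeᵒᵖ} (f : c ⟶ c') (γ : Γ.obj c)
    (x : X.obj ⟨c, γ⟩) (γ' : Γ.obj c') (x' : X.obj ⟨c', γ'⟩) (h : Γ.map f γ = γ')
    (hx : X.map (X := ⟨c, γ⟩) (Y := ⟨c', γ'⟩) ⟨f, h⟩ x = x') :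
    X.extend.map f ⟨γ, x⟩ = ⟨γ', x'⟩ := by
  subst h
  subst hx
  rfl

/-- The projection from `(γ : Γ) × X γ` to `Γ`. -/
def proj (X : Fam Γ) : X.extend ⟶ Γ where
  app _ := TypeCat.ofHom fun z => z.1
  naturality _ _ _ := rfl

/-- The element `(γ, x)` of `(γ : Γ) × X γ`, at some stage. -/
abbrev pair (X : Fam Γ) (e : Γ.Elements) (x : X.obj e) : X.extend.Elements := ⟨e.1, ⟨e.2, x⟩⟩

/-- Restriction of pairs. -/
def pairHom (X : Fam Γ) {e e' : Γ.Elements} (v : e ⟶ e') (x : X.obj e) :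
    X.pair e x ⟶ X.pair e' (X.map v x) :=
  ⟨v.1, X.extend_map_eq v.1 e.2 x e'.2 (X.map v x) v.2 rfl⟩

/-- The family of dependent sums `γ ↦ (x : X γ) × Y (γ, x)`. -/
def sigma (X : Fam Γ) (Y : Fam X.extend) : Fam Γ :=
  typeFunctor (fun e => Σ x : X.obj e, Y.obj (X.pair e x))
    (fun v z => ⟨X.map v z.1, Y.map (X.pairHom v z.1) z.2⟩)
    (fun e z => Sigma.ext (typeFunctor_map_id _ _)
      (map_id_heq Y (e := X.pair e z.1) (X.pairHom (𝟙 e) z.1).2 z.2))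
    (fun {e e' e''} v w z => by
      refine Sigma.ext (Functor.map_comp_apply _ _ _ _) ?_
      refine (map_heq Y (e := X.pair e z.1) (c := e''.1) (v ≫ w).1 (X.pairHom (v ≫ w) z.1).2
        (X.pairHom v z.1 ≫ X.pairHom w (X.map v z.1)).2 z.2).trans ?_
      exact heq_of_eq (Functor.map_comp_apply Y (X.pairHom v z.1)
        (X.pairHom w (X.map v z.1)) z.2))

end Fam

/-! ### Partial elements and extension structures -/

section Extension

variable {Γ : CSet.{u}}

/-- A partial element `[α] → X γ`, at the stage and for the `γ` given by `d`. -/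
@[ext]
structure PartialElt (X : Fam Γ) (d : Γ.Elements) (α : Cof d.1) where
  val : ∀ {d' : Γ.Elements} (v : d ⟶ d'), α.Holds v.1 → X.obj d'
  nat : ∀ {d' d'' : Γ.Elements} (v : d ⟶ d') (hv : α.Holds v.1) (w : d' ⟶ d''),
    X.map w (val v hv) = val (v ≫ w) (hv.comp w.1)

/-- Restriction of a partial element. -/
def PartialElt.res {X : Fam Γ} {d d' : Γ.Elements} {α : Cof d.1} (v : d ⟶ d')
    (x : PartialElt X d α) : PartialElt X d' (α.res v.1) where
  val w hw := x.val (v ≫ w) hw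
  nat w hw w' := by
    rw [x.nat (v ≫ w) hw w']
    congr 1
    exact Category.assoc _ _ _

/-- Extension structures on `X γ`, at the stage and for the `γ` given by `e`. -/
@[ext]
structure ExtAt (X : Fam Γ) (e : Γ.Elements) where
  total : ∀ {d : Γ.Elements} (_ : e ⟶ d) (α : Cof d.1) (_ : PartialElt X d α), X.obj d
  extends_partial : ∀ {d : Γ.Elements} (v : e ⟶ d) (α : Cof d.1) (x : PartialElt X d α)
    {d' : Γ.Elements} (w : d ⟶ d') (hw : α.Holds w.1), X.map w (total v α x) = x.val w hw
  nat : ∀ {d d' : Γ.Elements} (v : e ⟶ d) (α : Cof d.1) (x : PartialElt X d α) (w : d ⟶ d'),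
    X.map w (total v α x) = total (v ≫ w) (α.res w.1) (x.res w)

/-- Restriction of extension structures. -/
def ExtAt.res {X : Fam Γ} {e e' : Γ.Elements} (k : e ⟶ e') (E : ExtAt X e) : ExtAt X e' where
  total v α x := E.total (k ≫ v) α x
  extends_partial v α x _ w hw := E.extends_partial (k ≫ v) α x w hw
  nat v α x w := by rw [E.nat, Category.assoc]

/-- The family `γ ↦ ExtStr (X γ)` of extension structures. -/
def ExtStr (X : Fam Γ) : Fam Γ :=
  typeFunctor (fun e => ExtAt X e) (fun k E => E.res k)
    (fun e E => by
      apply ExtAt.ext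
      funext d v α x
      show E.total (𝟙 e ≫ v) α x = E.total v α x
      rw [Category.id_comp])
    (fun k l E => by
      apply ExtAt.ext
      funext d v α x
      show E.total ((k ≫ l) ≫ v) α x = E.total (k ≫ l ≫ v) α x
      rw [Category.assoc])

/-- The sets `X γ` (for `γ : Γ`) are trivially fibrant: there is a global family of extension
structures on them. -/
def TriviallyFibrant (X : Fam Γ) : Prop := Nonempty (Tm (ExtStr X))

end Extension

/-! ### Lines and weak composition structures -/

/-- The context `Γ × 𝕀`. -/
def ctxI (Γ : CSet.{u}) : CSet.{u} :=
  typeFunctor (fun c => Γ.obj c × II.obj c) (fun f z => (Γ.map f z.1, II.map f z.2))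
    (fun _ _ => Prod.ext (typeFunctor_map_id _ _) (typeFunctor_map_id _ _))
    (fun _ _ _ => Prod.ext (Functor.map_comp_apply _ _ _ _) (Functor.map_comp_apply _ _ _ _))

section Lines

variable {Γ : CSet.{u}}

/-- The element `(γ, i)` of `Γ × 𝕀`. -/
abbrev pairI (d : Γ.Elements) (i : II.obj d.1) : (ctxI Γ).Elements := ⟨d.1, (d.2, i)⟩

/-- Restriction of `(γ, i)`. -/
def pairIHom {d d' : Γ.Elements} (v : d ⟶ d') (i : II.obj d.1) :
    pairI d i ⟶ pairI d' (II.map v.1 i) :=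
  ⟨v.1, Prod.ext v.2 rfl⟩

/-- Elements of `(i : 𝕀) → Y (γ, i)`, at the stage and for the `γ` given by `e`. -/
@[ext]
structure PiIAt (Y : Fam (ctxI Γ)) (e : Γ.Elements) where
  val : ∀ {d : Γ.Elements} (_ : e ⟶ d) (i : II.obj d.1), Y.obj (pairI d i)
  nat : ∀ {d d' : Γ.Elements} (v : e ⟶ d) (i : II.obj d.1) (w : d ⟶ d'),
    Y.map (pairIHom w i) (val v i) = val (v ≫ w) (II.map w.1 i)

/-- Restriction of dependent lines. -/
def PiIAt.res {Y : Fam (ctxI Γ)} {e e' : Γ.Elements} (k : e ⟶ e') (y : PiIAt Y e) :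
    PiIAt Y e' where
  val v i := y.val (k ≫ v) i
  nat v i w := by rw [y.nat, Category.assoc]

/-- The family `γ ↦ ((i : 𝕀) → Y (γ, i))`. -/
def piI (Y : Fam (ctxI Γ)) : Fam Γ :=
  typeFunctor (fun e => PiIAt Y e) (fun k y => y.res k)
    (fun e y => by
      apply PiIAt.ext
      funext d v i
      show y.val (𝟙 e ≫ v) i = y.val v i
      rw [Category.id_comp])
    (fun k l y => by
      apply PiIAt.ext
      funext d v i
      show y.val ((k ≫ l) ≫ v) i = y.val (k ≫ l ≫ v) i
      rw [Category.assoc])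

/-- Evaluation of a dependent line at a point of the interval. -/
def PiIAt.app {Y : Fam (ctxI Γ)} {e : Γ.Elements} (y : PiIAt Y e) (i : II.obj e.1) :
    Y.obj (pairI e i) := y.val (𝟙 e) i

theorem PiIAt.map_app {Y : Fam (ctxI Γ)} {e e' : Γ.Elements} (y : PiIAt Y e)
    (w : e ⟶ e') (i : II.obj e.1) :
    Y.map (pairIHom w i) (y.app i) = (y.res w).app (II.map w.1 i) := by
  show Y.map (pairIHom w i) (y.val (𝟙 e) i) = y.val (w ≫ 𝟙 e') (II.map w.1 i)
  rw [y.nat, Category.id_comp, Category.comp_id]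

/-- The input of a composition problem from `r` in the line of sets `i ↦ Y (γ, i)`:
a cofibration `α`, a partial line `t : [α] → (s : 𝕀) → Y (γ, s)` and a base `b : Y (γ, r)`
such that `t r = b` under `α`. -/
structure ComInput (Y : Fam (ctxI Γ)) (d : Γ.Elements) (r : II.obj d.1) where
  cof : Cof d.1
  t : PartialElt (piI Y) d cof
  b : Y.obj (pairI d r)
  compat : ∀ {d' : Γ.Elements} (v : d ⟶ d') (hv : cof.Holds v.1),
    (t.val v hv).app (II.map v.1 r) = Y.map (pairIHom v r) b

/-- Restriction of a composition problem. -/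
def ComInput.res {Y : Fam (ctxI Γ)} {d d' : Γ.Elements} {r : II.obj d.1} (v : d ⟶ d')
    (S : ComInput Y d r) : ComInput Y d' (II.map v.1 r) where
  cof := S.cof.res v.1
  t := S.t.res v
  b := Y.map (pairIHom v r) S.b
  compat {d''} w hw := by
    have key : ∀ (j : II.obj d''.1) (e : II.map (v ≫ w).1 r = j)
        (k : pairI d' (II.map v.1 r) ⟶ pairI d'' j), k.1 = w.1 →
        (S.t.val (v ≫ w) hw).app j = Y.map k (Y.map (pairIHom v r) S.b) := by
      intro j e k hk
      subst e
      have hk' : pairIHom (v ≫ w) r = pairIHom v r ≫ k := by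
        apply Subtype.ext
        show (v ≫ w).1 = v.1 ≫ k.1
        rw [hk]
        rfl
      rw [S.compat (v ≫ w) hw, ← Functor.map_comp_apply, hk']
    exact key _ (Functor.map_comp_apply II v.1 w.1 r) (pairIHom w (II.map v.1 r)) rfl

/-- Weak composition structures on the line of sets `i ↦ Y (γ, i)`, at the stage and for the `γ`
given by `e`. The field `path` is the family of paths from `wcom r r` to the base. -/
@[ext]
structure WComAt (Y : Fam (ctxI Γ)) (e : Γ.Elements) where
  wcom : ∀ {d : Γ.Elements} (_ : e ⟶ d) (r s : II.obj d.1) (_ : ComInput Y d r),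
    Y.obj (pairI d s)
  wcom_extends : ∀ {d : Γ.Elements} (v : e ⟶ d) (r s : II.obj d.1) (S : ComInput Y d r)
    {d' : Γ.Elements} (w : d ⟶ d') (hw : S.cof.Holds w.1),
    Y.map (pairIHom w s) (wcom v r s S) = (S.t.val w hw).app (II.map w.1 s)
  wcom_nat : ∀ {d d' : Γ.Elements} (v : e ⟶ d) (r s : II.obj d.1) (S : ComInput Y d r)
    (w : d ⟶ d'), Y.map (pairIHom w s) (wcom v r s S) =
      wcom (v ≫ w) (II.map w.1 r) (II.map w.1 s) (S.res w)
  path : ∀ {d : Γ.Elements} (_ : e ⟶ d) (r : II.obj d.1) (_ : ComInput Y d r) (_ : II.obj d.1),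
    Y.obj (pairI d r)
  path_zero : ∀ {d : Γ.Elements} (v : e ⟶ d) (r : II.obj d.1) (S : ComInput Y d r),
    path v r S (II.zero d.1) = wcom v r r S
  path_one : ∀ {d : Γ.Elements} (v : e ⟶ d) (r : II.obj d.1) (S : ComInput Y d r),
    path v r S (II.one d.1) = S.b
  path_extends : ∀ {d : Γ.Elements} (v : e ⟶ d) (r : II.obj d.1) (S : ComInput Y d r)
    (i : II.obj d.1) {d' : Γ.Elements} (w : d ⟶ d') (_ : S.cof.Holds w.1),
    Y.map (pairIHom w r) (path v r S i) = Y.map (pairIHom w r) S.b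
  path_nat : ∀ {d d' : Γ.Elements} (v : e ⟶ d) (r : II.obj d.1) (S : ComInput Y d r)
    (i : II.obj d.1) (w : d ⟶ d'), Y.map (pairIHom w r) (path v r S i) =
      path (v ≫ w) (II.map w.1 r) (S.res w) (II.map w.1 i)

/-- Restriction of weak composition structures. -/
def WComAt.res {Y : Fam (ctxI Γ)} {e e' : Γ.Elements} (k : e ⟶ e') (W : WComAt Y e) :
    WComAt Y e' where
  wcom v r s S := W.wcom (k ≫ v) r s S
  wcom_extends v r s S _ w hw := W.wcom_extends (k ≫ v) r s S w hw
  wcom_nat v r s S w := by rw [W.wcom_nat, Category.assoc]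
  path v r S i := W.path (k ≫ v) r S i
  path_zero v r S := W.path_zero (k ≫ v) r S
  path_one v r S := W.path_one (k ≫ v) r S
  path_extends v r S i _ w hw := W.path_extends (k ≫ v) r S i w hw
  path_nat v r S i w := by rw [W.path_nat, Category.assoc]

/-- The family `γ ↦ HasWCom (i ↦ Y (γ, i))` of weak composition structures. -/
def HasWCom (Y : Fam (ctxI Γ)) : Fam Γ :=
  typeFunctor (fun e => WComAt Y e) (fun k W => W.res k)
    (fun e W => by
      apply WComAt.ext
      · funext d v r s S
        show W.wcom (𝟙 e ≫ v) r s S = W.wcom v r s S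
        rw [Category.id_comp]
      · funext d v r S i
        show W.path (𝟙 e ≫ v) r S i = W.path v r S i
        rw [Category.id_comp])
    (fun k l W => by
      apply WComAt.ext
      · funext d v r s S
        show W.wcom ((k ≫ l) ≫ v) r s S = W.wcom (k ≫ l ≫ v) r s S
        rw [Category.assoc]
      · funext d v r S i
        show W.path ((k ≫ l) ≫ v) r S i = W.path (k ≫ l ≫ v) r S i
        rw [Category.assoc])

end Lines

/-! ### The exponential by the interval, its right adjoint, and fibrancy -/

/-- The elements over the stage `c` of the exponential `A^𝕀`: natural families of maps
from `y(c) × 𝕀` to `A`. -/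
@[ext]
structure Line (A : CSet.{u}) (c : Cubeᵒᵖ) where
  val : ∀ {c' : Cubeᵒᵖ} (_ : c ⟶ c') (_ : II.obj c'), A.obj c'
  nat : ∀ {c' c'' : Cubeᵒᵖ} (f : c ⟶ c') (i : II.obj c') (g : c' ⟶ c''),
    A.map g (val f i) = val (f ≫ g) (II.map g i)

/-- Restriction of a line. -/
def Line.res {A : CSet.{u}} {c c' : Cubeᵒᵖ} (f : c ⟶ c') (a : Line A c) : Line A c' where
  val g i := a.val (f ≫ g) i
  nat g i h := by rw [a.nat, Category.assoc]

/-- The image of a line under a map of cubical sets. -/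
def Line.map {A B : CSet.{u}} (σ : A ⟶ B) {c : Cubeᵒᵖ} (a : Line A c) : Line B c where
  val f i := σ.app _ (a.val f i)
  nat f i g := by rw [← a.nat, NatTrans.naturality_apply]

/-- Evaluation of a line at a point of the interval. -/
def Line.app {A : CSet.{u}} {c : Cubeᵒᵖ} (a : Line A c) (i : II.obj c) : A.obj c := a.val (𝟙 c) i

theorem Line.map_app {A : CSet.{u}} {c c' : Cubeᵒᵖ} (a : Line A c) (f : c ⟶ c') (i : II.obj c) :
    A.map f (a.app i) = (a.res f).app (II.map f i) := by
  show A.map f (a.val (𝟙 c) i) = a.val (f ≫ 𝟙 c') (II.map f i)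
  rw [a.nat, Category.id_comp, Category.comp_id]

/-- The cubical set `A^𝕀`. -/
def pathObj (A : CSet.{u}) : CSet.{u} :=
  typeFunctor (fun c => Line A c) (fun f a => a.res f)
    (fun c a => by
      apply Line.ext
      funext d f i
      show a.val (𝟙 c ≫ f) i = a.val f i
      rw [Category.id_comp])
    (fun f g a => by
      apply Line.ext
      funext d h i
      show a.val ((f ≫ g) ≫ h) i = a.val (f ≫ g ≫ h) i
      rw [Category.assoc])

/-- The evaluation map `A^𝕀 × 𝕀 ⟶ A`. -/
def ev (A : CSet.{u}) : ctxI (pathObj A) ⟶ A where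
  app _ := TypeCat.ofHom fun z => Line.app z.1 z.2
  naturality c c' f := by
    refine ConcreteCategory.hom_ext _ _ fun z => ?_
    exact (Line.map_app z.1 f z.2).symm

section Tiny

variable {A : CSet.{u}}

/-- For `e = (J, a)` with `a : y(J) ⟶ A`, and `p` an element of `A^𝕀`: the elements of `y(J)^𝕀`
(at the stage of `p`) that are sent to `p` by `a^𝕀 : y(J)^𝕀 ⟶ A^𝕀`. -/
@[ext]
structure LineOver (e : A.Elements) (p : (pathObj A).Elements) where
  line : Line (yoneda.obj e.1.unop) p.1
  comm : ∀ {c : Cubeᵒᵖ} (f : p.1 ⟶ c) (i : II.obj c),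
    A.map (Quiver.Hom.op (line.val f i)) e.2 = Line.val p.2 f i

/-- Restriction of a line in `y(J)`. -/
def LineOver.res {e : A.Elements} {p p' : (pathObj A).Elements} (v : p ⟶ p') (l : LineOver e p) :
    LineOver e p' where
  line := l.line.res v.1
  comm f i := by
    have h : Line.res v.1 p.2 = p'.2 := v.2
    exact (l.comm (v.1 ≫ f) i).trans (congrArg (fun a : Line A _ => a.val f i) h)

/-- Postcomposition of a line in `y(J')` with a map `y(J') ⟶ y(J)` over `A`. -/
def LineOver.push {e e' : A.Elements} {p : (pathObj A).Elements} (k : e ⟶ e')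
    (l : LineOver e' p) : LineOver e p where
  line := l.line.map (yoneda.map k.1.unop)
  comm f i :=
    (Functor.map_comp_apply A k.1 (Quiver.Hom.op (l.line.val f i)) e.2).trans
      ((congrArg (A.map (Quiver.Hom.op (l.line.val f i))) k.2).trans (l.comm f i))

theorem LineOver.push_id {e : A.Elements} {p : (pathObj A).Elements} (l : LineOver e p) :
    l.push (𝟙 e) = l := rfl

theorem LineOver.push_comp {e e' e'' : A.Elements} {p : (pathObj A).Elements} (k : e ⟶ e')
    (k' : e' ⟶ e'') (l : LineOver e'' p) : l.push (k ≫ k') = (l.push k').push k := by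
  apply LineOver.ext
  apply Line.ext
  funext c f i
  exact Functor.map_comp_apply (coyoneda.obj (op c.unop)) k'.1.unop k.1.unop
    (l.line.val f i)

/-- The elements of the right adjoint `C_𝕀` at `e = (J, a)`: global elements of
`(l : y(J)^𝕀) → C (a^𝕀 l)`. -/
@[ext]
structure TinyAt (C : Fam (pathObj A)) (e : A.Elements) where
  val : ∀ {p : (pathObj A).Elements} (_ : LineOver e p), C.obj p
  nat : ∀ {p p' : (pathObj A).Elements} (l : LineOver e p) (v : p ⟶ p'),
    C.map v (val l) = val (l.res v)

/-- Restriction of elements of `C_𝕀`. -/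
def TinyAt.res {C : Fam (pathObj A)} {e e' : A.Elements} (k : e ⟶ e') (z : TinyAt C e) :
    TinyAt C e' where
  val l := z.val (l.push k)
  nat l v := z.nat (l.push k) v

/-- The action `C ↦ C_𝕀`, from families over `A^𝕀` to families over `A`, of the right adjoint
of `(-)^𝕀` (the interval is tiny). -/
def tinyRight (C : Fam (pathObj A)) : Fam A :=
  typeFunctor (fun e => TinyAt C e)
    (fun k z => z.res k)
    (fun e z => rfl)
    (fun k k' z => by
      apply TinyAt.ext
      funext p l
      show z.val (l.push (k ≫ k')) = z.val ((l.push k').push k)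
      rw [l.push_comp])

end Tiny

/-- The family `a ↦ HasWCom_𝕀 (B a)` of fibrancy structures. It is obtained by applying the
right adjoint to the family `a ↦ HasWCom (i ↦ B (a i))` over `A^𝕀`. -/
def HasFib {A : CSet.{u}} (B : Fam A) : Fam A := tinyRight (HasWCom (B.sub (ev A)))

/-- The global family `B` is a family of fibrant sets: there is a global element of
`(a : A) → HasWCom_𝕀 (B a)`. -/
def IsFibrantFamily {A : CSet.{u}} (B : Fam A) : Prop := Nonempty (Tm (HasFib B))

/-! ### Pseudo-reflexive graphs -/

open FunctorToTypes (prod)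

/-- The diagonal `A ⟶ A × A`. -/
def diag (A : CSet.{u}) : A ⟶ prod A A where
  app _ := TypeCat.ofHom fun a => (a, a)
  naturality _ _ _ := rfl

/-- A global pseudo-reflexive graph `V : Set`, `E : V → V → Set`,
`R : (a : V) → E a a → Set`. -/
structure PseudoReflGraph where
  V : CSet.{u}
  E : Fam (prod V V)
  R : Fam (E.sub (diag V)).extend

namespace PseudoReflGraph

/-- The cubical set of `a₁ a₂ : V` with `aₑ : E a₁ a₂`. -/
abbrev Edges (G : PseudoReflGraph.{u}) : CSet.{u} := G.E.extend

/-- The cubical set of `a : V` with `aₑ : E a a` and `aᵣ : R a aₑ`. -/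
abbrev Loops (G : PseudoReflGraph.{u}) : CSet.{u} := G.R.extend

/-- The first endpoint of an edge. -/
def src (G : PseudoReflGraph.{u}) : G.Edges ⟶ G.V := G.E.proj ≫ FunctorToTypes.prod.fst

/-- The second endpoint of an edge. -/
def tgt (G : PseudoReflGraph.{u}) : G.Edges ⟶ G.V := G.E.proj ≫ FunctorToTypes.prod.snd

/-- The vertex of a reflexive loop. -/
def vertex (G : PseudoReflGraph.{u}) : G.Loops ⟶ G.V := G.R.proj ≫ (G.E.sub (diag G.V)).proj

/-- The context of `a₁ a₂ : V`, `aₑ : E a₁ a₂`, `b₁ : B a₁`. -/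
abbrev EdgeSrcCtx (G : PseudoReflGraph.{u}) (B : Fam G.V) : CSet.{u} := (B.sub G.src).extend

/-- Over that context, the family `B a₂`. -/
abbrev edgeTgt (G : PseudoReflGraph.{u}) (B : Fam G.V) : Fam (G.EdgeSrcCtx B) :=
  B.sub ((B.sub G.src).proj ≫ G.tgt)

/-- The context of `a₁ a₂ : V`, `aₑ : E a₁ a₂`, `b₁ : B a₁`, `b₂ : B a₂`. -/
abbrev EdgeCtx (G : PseudoReflGraph.{u}) (B : Fam G.V) : CSet.{u} := (G.edgeTgt B).extend

/-- The context of `a : V`, `aₑ : E a a`, `aᵣ : R a aₑ`, `b : B a`. -/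
abbrev LoopCtx (G : PseudoReflGraph.{u}) (B : Fam G.V) : CSet.{u} := (B.sub G.vertex).extend

/-- The map `(a, aₑ, aᵣ, b) ↦ (a, a, aₑ, b, b)`. -/
def loopToEdge (G : PseudoReflGraph.{u}) (B : Fam G.V) : G.LoopCtx B ⟶ G.EdgeCtx B where
  app _ := TypeCat.ofHom fun z => ⟨⟨⟨(z.1.1.1, z.1.1.1), z.1.1.2⟩, z.2⟩, z.2⟩
  naturality _ _ _ := rfl

end PseudoReflGraph

/-- A global dependent pseudo-reflexive graph over `G`: families `B a`,
`E aₑ b₁ b₂` (for `aₑ : E_A a₁ a₂`, `b₁ : B a₁`, `b₂ : B a₂`) and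
`R aᵣ b bₑ` (for `aᵣ : R_A a aₑ`, `b : B a`, `bₑ : E aₑ b b`). -/
structure DepPseudoReflGraph (G : PseudoReflGraph.{u}) where
  B : Fam G.V
  E : Fam (G.EdgeCtx B)
  R : Fam (E.sub (G.loopToEdge B)).extend

/-! ### Weak coercion structures -/

namespace PseudoReflGraph

/-- The map `(a, r, s) ↦ (a r, a s)` from `V^𝕀 × 𝕀 × 𝕀` to `V × V`. -/
def evPair (G : PseudoReflGraph.{u}) : ctxI (ctxI (pathObj G.V)) ⟶ prod G.V G.V where
  app _ := TypeCat.ofHom fun z => (Line.app z.1.1 z.1.2, Line.app z.1.1 z.2)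
  naturality c c' f := by
    refine ConcreteCategory.hom_ext _ _ fun z => ?_
    exact (Prod.ext (Line.map_app z.1.1 f z.1.2) (Line.map_app z.1.1 f z.2)).symm

/-- The map `(a, r) ↦ (a r, wcoe a r r)`. -/
def wcoeDiag (G : PseudoReflGraph.{u}) (wcoe : Tm (G.E.sub G.evPair)) :
    ctxI (pathObj G.V) ⟶ (G.E.sub (diag G.V)).extend where
  app c := TypeCat.ofHom fun z =>
    ⟨Line.app z.1 z.2, wcoe.1 ⟨c, ((z.1, z.2), z.2)⟩⟩
  naturality c c' f := by
    refine ConcreteCategory.hom_ext _ _ fun z => ?_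
    refine (Fam.extend_map_eq (G.E.sub (diag G.V)) f _ _ _ _ (Line.map_app z.1 f z.2) ?_).symm
    exact wcoe.2 (j := ⟨c, ((z.1, z.2), z.2)⟩)
      (j' := ⟨c', ((Line.res f z.1, II.map f z.2), II.map f z.2)⟩) ⟨f, rfl⟩

/-- A (global) weak coercion structure: `wcoe a r s : E (a r) (a s)` and
`wcoh a r : R (a r) (wcoe a r r)` for `a : 𝕀 → V` and `r s : 𝕀`. -/
structure WeakCoercion (G : PseudoReflGraph.{u}) where
  wcoe : Tm (G.E.sub G.evPair)
  wcoh : Tm (G.R.sub (G.wcoeDiag wcoe))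

end PseudoReflGraph

namespace DepPseudoReflGraph

variable {G : PseudoReflGraph.{u}}

/-- The family `a ↦ ((i : 𝕀) → B (a i))` over `V^𝕀`. -/
abbrev lineFam (D : DepPseudoReflGraph G) : Fam (pathObj G.V) := piI (D.B.sub (ev G.V))

/-- The context of `a : 𝕀 → V` and `b : (i : 𝕀) → B (a i)`. -/
abbrev LineCtx (D : DepPseudoReflGraph G) : CSet.{u} := D.lineFam.extend

/-- For `b : (i : 𝕀) → B (a i)` and `r : 𝕀`, the element `b r : B (a r)`. -/
abbrev lineApp (D : DepPseudoReflGraph G) {c : Cubeᵒᵖ} (z : D.LineCtx.obj c) (r : II.obj c) :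
    D.B.obj ⟨c, Line.app z.1 r⟩ :=
  PiIAt.app (Y := D.B.sub (ev G.V)) (e := ⟨c, z.1⟩) z.2 r

theorem map_lineApp (D : DepPseudoReflGraph G) {c c' : Cubeᵒᵖ} (f : c ⟶ c')
    (z : D.LineCtx.obj c) (r : II.obj c) :
    D.B.map (X := ⟨c, Line.app z.1 r⟩)
      (Y := ⟨c', Line.app (D.LineCtx.map f z).1 (II.map f r)⟩)
      ⟨f, Line.map_app z.1 f r⟩ (D.lineApp z r) = D.lineApp (D.LineCtx.map f z) (II.map f r) :=
  PiIAt.map_app (Y := D.B.sub (ev G.V)) (e := ⟨c, z.1⟩) (e' := ⟨c', Line.res f z.1⟩)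
    z.2 ⟨f, rfl⟩ r

/-- The map `(a, b, r, s) ↦ (a r, a s, wcoe a r s, b r, b s)`. -/
def wcoeCtx (D : DepPseudoReflGraph G) (W : G.WeakCoercion) :
    ctxI (ctxI D.LineCtx) ⟶ G.EdgeCtx D.B where
  app c := TypeCat.ofHom fun z =>
    ⟨⟨⟨(Line.app z.1.1.1 z.1.2, Line.app z.1.1.1 z.2), W.wcoe.1 ⟨c, ((z.1.1.1, z.1.2), z.2)⟩⟩,
      D.lineApp z.1.1 z.1.2⟩, D.lineApp z.1.1 z.2⟩
  naturality c c' f := by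
    refine ConcreteCategory.hom_ext _ _ fun z => ?_
    symm
    refine Fam.extend_map_eq (G.edgeTgt D.B) f _ _ _ _
      (Fam.extend_map_eq (D.B.sub G.src) f _ _ _ _
        (Fam.extend_map_eq G.E f _ _ _ _
          (Prod.ext (Line.map_app z.1.1.1 f z.1.2) (Line.map_app z.1.1.1 f z.2)) ?_) ?_) ?_
    · exact W.wcoe.2 (j := ⟨c, ((z.1.1.1, z.1.2), z.2)⟩)
        (j' := ⟨c', ((Line.res f z.1.1.1, II.map f z.1.2), II.map f z.2)⟩) ⟨f, rfl⟩
    · exact D.map_lineApp f z.1.1 z.1.2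
    · exact D.map_lineApp f z.1.1 z.2

/-- The map `(a, b, r) ↦ (a r, wcoe a r r, wcoh a r, b r, wcoe b r r)`. -/
def wcohCtx (D : DepPseudoReflGraph G) (W : G.WeakCoercion)
    (wcoe : Tm (D.E.sub (D.wcoeCtx W))) :
    ctxI D.LineCtx ⟶ (D.E.sub (G.loopToEdge D.B)).extend where
  app c := TypeCat.ofHom fun z =>
    ⟨⟨⟨⟨Line.app z.1.1 z.2, W.wcoe.1 ⟨c, ((z.1.1, z.2), z.2)⟩⟩, W.wcoh.1 ⟨c, (z.1.1, z.2)⟩⟩,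
      D.lineApp z.1 z.2⟩, wcoe.1 ⟨c, ((z.1, z.2), z.2)⟩⟩
  naturality c c' f := by
    refine ConcreteCategory.hom_ext _ _ fun z => ?_
    symm
    refine Fam.extend_map_eq (D.E.sub (G.loopToEdge D.B)) f _ _ _ _
      (Fam.extend_map_eq (D.B.sub G.vertex) f _ _ _ _
        (Fam.extend_map_eq G.R f _ _ _ _
          (Fam.extend_map_eq (G.E.sub (diag G.V)) f _ _ _ _ (Line.map_app z.1.1 f z.2) ?_)
          ?_) ?_) ?_
    · exact W.wcoe.2 (j := ⟨c, ((z.1.1, z.2), z.2)⟩)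
        (j' := ⟨c', ((Line.res f z.1.1, II.map f z.2), II.map f z.2)⟩) ⟨f, rfl⟩
    · exact W.wcoh.2 (j := ⟨c, (z.1.1, z.2)⟩)
        (j' := ⟨c', (Line.res f z.1.1, II.map f z.2)⟩) ⟨f, rfl⟩
    · exact D.map_lineApp f z.1 z.2
    · exact wcoe.2 (j := ⟨c, ((z.1, z.2), z.2)⟩)
        (j' := ⟨c', ((D.LineCtx.map f z.1, II.map f z.2), II.map f z.2)⟩) ⟨f, rfl⟩

/-- A (global) weak coercion structure over the weak coercion structure `W` of the base:
`wcoe b r s : E (wcoe a r s) (b r) (b s)` and `wcoh b r : R (wcoh a r) (b r) (wcoe b r r)`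
for `a : 𝕀 → V`, `b : (i : 𝕀) → B (a i)` and `r s : 𝕀`. -/
structure WeakCoercion (D : DepPseudoReflGraph G) (W : G.WeakCoercion) where
  wcoe : Tm (D.E.sub (D.wcoeCtx W))
  wcoh : Tm (D.R.sub (D.wcohCtx W wcoe))

/-- The dependent graph is homotopical: the sets `(b₂ : B a₂) × E aₑ b₁ b₂`, for
`aₑ : E_A a₁ a₂` and `b₁ : B a₁`, and the sets `(bₑ : E aₑ b b) × R aᵣ b bₑ`, for
`aᵣ : R_A a aₑ` and `b : B a`, are trivially fibrant. -/
structure IsHomotopical (D : DepPseudoReflGraph G) : Prop where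
  edge : TriviallyFibrant ((G.edgeTgt D.B).sigma D.E)
  loop : TriviallyFibrant ((D.E.sub (G.loopToEdge D.B)).sigma D.R)

end DepPseudoReflGraph

/-!
A fibrancy structure on `B` is the transpose of a global weak composition structure on the families
`i ↦ B (a i)` for `a : 𝕀 → A`, so it is enough to compose there. Let `t : [α] → (s : 𝕀) → B (a s)`
and `b : B (a r)` with `t r = b` under `α`.

Under `α`, weak coercion along the line `t` gives an edge `wcoe t r s` from `b = t r` to `t s` over
`wcoe a r s`. Thus `(t s, wcoe t r s)` is a partial element of the trivially fibrant set
`(b₂ : B (a s)) × E (wcoe a r s) b b₂`, and `wcom r s` is the first component of its extension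
(`edgeTube`).

For `s = r` there is a second extension of the same partial element: under `α` there are
`wcoe t r r : E (wcoe a r r) b b` and `wcoh t r` in `R (wcoh a r) b (wcoe t r r)`; these extend to a
total reflexive loop `bₑ` at `b` (`loopTube`), and `(b, bₑ)` is the second extension. Two extensions
of a partial element of a trivially fibrant set are joined by a path constant under `α`, obtained by
extending along `α ∨ (i = 0) ∨ (i = 1)` (`PathProblem.fill`); its first component is a path from
`wcom r r` to `b`.

Everything is natural in the stage, as the extension operations, the coercions and all the partial
elements above are stable under restriction.
-/

/-! ### Extension operations and paths between extensions -/

section Extension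

variable {Γ : CSet.{u}}

/-- A global family of extension structures on the sets `X γ`: one operation on the partial
elements at all stages, stable under restriction. Unlike `ExtAt`, which is relative to a stage,
it takes no restriction map as an argument. -/
structure ExtOp (X : Fam Γ) where
  total : ∀ {e : Γ.Elements} (α : Cof e.1) (_ : PartialElt X e α), X.obj e
  map_total : ∀ {e e' : Γ.Elements} (α : Cof e.1) (x : PartialElt X e α) (w : e ⟶ e')
    (hw : α.Holds w.1), X.map w (total α x) = x.val w hw
  total_nat : ∀ {e e' : Γ.Elements} (α : Cof e.1) (x : PartialElt X e α) (w : e ⟶ e'),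
    X.map w (total α x) = total (α.res w.1) (x.res w)

theorem TriviallyFibrant.nonempty_extOp {X : Fam Γ} (h : TriviallyFibrant X) :
    Nonempty (ExtOp X) := by
  obtain ⟨T⟩ := h
  refine ⟨⟨fun {e} α x => (T.1 e).total (𝟙 e) α x,
    fun {e e'} α x w hw => (T.1 e).extends_partial (𝟙 e) α x w hw, fun {e e'} α x w => ?_⟩⟩
  have hT : (T.1 e).res w = T.1 e' := T.2 w
  rw [(T.1 e).nat, ← hT]
  show _ = (T.1 e).total (w ≫ 𝟙 e') _ _
  rw [Category.id_comp, Category.comp_id]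

/-- The value of an extension operation depends only on the values of the partial element, also
when its cofibration is presented in two ways. -/
theorem ExtOp.total_congr {X : Fam Γ} (T : ExtOp X) {e : Γ.Elements} {α β : Cof e.1}
    {x : PartialElt X e α} {y : PartialElt X e β} (h : α = β)
    (hxy : ∀ {e' : Γ.Elements} (v : e ⟶ e') (hv : α.Holds v.1) (hv' : β.Holds v.1),
      x.val v hv = y.val v hv') : T.total α x = T.total β y := by
  subst h
  congr 1
  apply PartialElt.ext
  funext e' v hv
  exact hxy v hv hv

/-- The cofibration `α ∨ (i = 0) ∨ (i = 1)`. -/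
def Cof.withEnds {c : Cubeᵒᵖ} (α : Cof c) (i : II.obj c) : Cof c :=
  ⟨α.1 ⊔ (eqSieve i (II.zero c) ⊔ eqSieve i (II.one c)), .or α.2 (.or (.eq _ _) (.eq _ _))⟩

theorem Cof.withEnds_holds {c c' : Cubeᵒᵖ} (α : Cof c) (i : II.obj c) (f : c ⟶ c') :
    (α.withEnds i).Holds f ↔
      α.Holds f ∨ II.map f i = II.zero c' ∨ II.map f i = II.one c' := Iff.rfl

theorem Cof.withEnds_res {c c' : Cubeᵒᵖ} (α : Cof c) (i : II.obj c) (f : c ⟶ c') :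
    (α.withEnds i).res f = (α.res f).withEnds (II.map f i) := by
  apply Subtype.ext
  ext k g
  have := Functor.map_comp_apply II f g.op i
  show (α.Holds (f ≫ g.op) ∨ II.map (f ≫ g.op) i = II.zero _ ∨ II.map (f ≫ g.op) i = II.one _)
    ↔ (α.Holds (f ≫ g.op) ∨ II.map g.op (II.map f i) = II.zero _ ∨
      II.map g.op (II.map f i) = II.one _)
  rw [this]

theorem II.zero_ne_one (c : Cubeᵒᵖ) : II.zero c ≠ II.one c := by
  intro h
  have h' : (Sum.inr false : c.unop.Pt) = Sum.inr true := h
  simp at h'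

/-- A partial element `x : [α] → X γ` with two total elements that extend it. -/
structure PathProblem (X : Fam Γ) (e : Γ.Elements) (α : Cof e.1) where
  x : PartialElt X e α
  x₀ : X.obj e
  x₁ : X.obj e
  left : ∀ {e' : Γ.Elements} (v : e ⟶ e') (hv : α.Holds v.1), X.map v x₀ = x.val v hv
  right : ∀ {e' : Γ.Elements} (v : e ⟶ e') (hv : α.Holds v.1), X.map v x₁ = x.val v hv

namespace PathProblem

variable {X : Fam Γ} {e : Γ.Elements} {α : Cof e.1} (P : PathProblem X e α) (i : II.obj e.1)

/-- The values of `x` under `α`, of `x₀` under `i = 0` and of `x₁` under `i = 1` can be glued: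
`x₀` and `x₁` both agree with `x`, and `i = 0` and `i = 1` exclude each other. -/
theorem exists_glue {e' : Γ.Elements} (v : e ⟶ e') :
    ∃ y : X.obj e', (∀ hv : α.Holds v.1, y = P.x.val v hv) ∧
      (II.map v.1 i = II.zero e'.1 → y = X.map v P.x₀) ∧
      (II.map v.1 i = II.one e'.1 → y = X.map v P.x₁) := by
  by_cases h : II.map v.1 i = II.zero e'.1
  · exact ⟨X.map v P.x₀, P.left v, fun _ => rfl,
      fun h₁ => absurd (h.symm.trans h₁) (II.zero_ne_one _)⟩
  · exact ⟨X.map v P.x₁, P.right v, fun h₀ => absurd h₀ h, fun _ => rfl⟩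

/-- The partial element of extent `α ∨ (i = 0) ∨ (i = 1)` glued from `x`, `x₀` and `x₁`. -/
noncomputable def glue : PartialElt X e (α.withEnds i) where
  val v _ := (P.exists_glue i v).choose
  nat {d' d''} v hv w := by
    have hv₁ := (P.exists_glue i v).choose_spec
    have hw₁ := (P.exists_glue i (v ≫ w)).choose_spec
    have hi : II.map (v ≫ w).1 i = II.map w.1 (II.map v.1 i) :=
      Functor.map_comp_apply II v.1 w.1 i
    rcases (α.withEnds_holds i v.1).1 hv with hv | hv | hv
    · rw [hv₁.1 hv, hw₁.1 (hv.comp w.1), P.x.nat]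
    · rw [hv₁.2.1 hv, hw₁.2.1 (hi.trans (congrArg _ hv)), Functor.map_comp_apply]
    · rw [hv₁.2.2 hv, hw₁.2.2 (hi.trans (congrArg _ hv)), Functor.map_comp_apply]

theorem glue_val_cof {e' : Γ.Elements} (v : e ⟶ e') (h) (hv : α.Holds v.1) :
    (P.glue i).val v h = P.x.val v hv := (P.exists_glue i v).choose_spec.1 hv

theorem glue_val_zero {e' : Γ.Elements} (v : e ⟶ e') (h) (hv : II.map v.1 i = II.zero e'.1) :
    (P.glue i).val v h = X.map v P.x₀ := (P.exists_glue i v).choose_spec.2.1 hv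

theorem glue_val_one {e' : Γ.Elements} (v : e ⟶ e') (h) (hv : II.map v.1 i = II.one e'.1) :
    (P.glue i).val v h = X.map v P.x₁ := (P.exists_glue i v).choose_spec.2.2 hv

/-- Restriction of a pair of extensions. -/
def res {e' : Γ.Elements} (w : e ⟶ e') : PathProblem X e' (α.res w.1) where
  x := P.x.res w
  x₀ := X.map w P.x₀
  x₁ := X.map w P.x₁
  left v hv := by rw [← Functor.map_comp_apply]; exact P.left (w ≫ v) hv
  right v hv := by rw [← Functor.map_comp_apply]; exact P.right (w ≫ v) hv

/-- The point at `i` of a path from `x₀` to `x₁`, constant under `α`: any two extensions of a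
partial element of a trivially fibrant set are joined by a path relative to it. -/
noncomputable def fill (T : ExtOp X) : X.obj e := T.total (α.withEnds i) (P.glue i)

theorem fill_zero (T : ExtOp X) : P.fill (II.zero e.1) T = P.x₀ := by
  have hi : II.map (𝟙 e : e ⟶ e).1 (II.zero e.1) = II.zero e.1 := rfl
  have h := (T.map_total _ (P.glue (II.zero e.1)) (𝟙 e)
    ((α.withEnds_holds _ _).2 (Or.inr (Or.inl hi)))).trans (P.glue_val_zero _ _ _ hi)
  rwa [typeFunctor_map_id, typeFunctor_map_id] at h

theorem fill_one (T : ExtOp X) : P.fill (II.one e.1) T = P.x₁ := by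
  have hi : II.map (𝟙 e : e ⟶ e).1 (II.one e.1) = II.one e.1 := rfl
  have h := (T.map_total _ (P.glue (II.one e.1)) (𝟙 e)
    ((α.withEnds_holds _ _).2 (Or.inr (Or.inr hi)))).trans (P.glue_val_one _ _ _ hi)
  rwa [typeFunctor_map_id, typeFunctor_map_id] at h

theorem map_fill_of_holds (T : ExtOp X) {e' : Γ.Elements} (w : e ⟶ e') (hw : α.Holds w.1) :
    X.map w (P.fill i T) = P.x.val w hw :=
  (T.map_total _ _ w ((α.withEnds_holds i w.1).2 (Or.inl hw))).trans (P.glue_val_cof i w _ hw)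

theorem map_fill (T : ExtOp X) {e' : Γ.Elements} (w : e ⟶ e') :
    X.map w (P.fill i T) = (P.res w).fill (II.map w.1 i) T := by
  refine (T.total_nat _ _ w).trans (T.total_congr (α.withEnds_res i w.1) ?_)
  intro d v hv hv'
  have hi : II.map (w ≫ v).1 i = II.map v.1 (II.map w.1 i) :=
    Functor.map_comp_apply II w.1 v.1 i
  show (P.glue i).val (w ≫ v) hv = _
  rcases (Cof.withEnds_holds _ _ _).1 hv' with h | h | h
  · exact (P.glue_val_cof i (w ≫ v) hv h).trans
      ((P.res w).glue_val_cof _ v _ h).symm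
  · exact (P.glue_val_zero i (w ≫ v) hv (hi.trans h)).trans
      ((Functor.map_comp_apply X w v P.x₀).trans ((P.res w).glue_val_zero _ v _ h).symm)
  · exact (P.glue_val_one i (w ≫ v) hv (hi.trans h)).trans
      ((Functor.map_comp_apply X w v P.x₁).trans ((P.res w).glue_val_one _ v _ h).symm)

theorem fill_congr (T : ExtOp X) {β : Cof e.1} {P Q : PathProblem X e β} (hx : P.x = Q.x)
    (h₀ : P.x₀ = Q.x₀) (h₁ : P.x₁ = Q.x₁) : P.fill i T = Q.fill i T := by
  cases P; cases Q; cases hx; cases h₀; cases h₁; rfl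

end PathProblem

/-! ### Partial elements of cubical sets -/

/-- A partial element `[α] → K` of a cubical set `K`, at the stage `c`. -/
structure PartialPt (K : CSet.{u}) (c : Cubeᵒᵖ) (α : Cof c) where
  val : ∀ {c' : Cubeᵒᵖ} (f : c ⟶ c'), α.Holds f → K.obj c'
  nat : ∀ {c' c'' : Cubeᵒᵖ} (f : c ⟶ c') (hf : α.Holds f) (g : c' ⟶ c''),
    K.map g (val f hf) = val (f ≫ g) (hf.comp g)

/-- For a global element `τ` of `(z : K) → X (ρ z)` and a partial element `k` of `K` lying over
`γ`, the partial element `τ k` of `X γ`. As `ρ k` is only propositionally equal to `γ`, the value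
is transported by a restriction along an identity of cubes rather than by a cast. -/
def PartialPt.lift {K : CSet.{u}} {ρ : K ⟶ Γ} {X : Fam Γ} (τ : Tm (X.sub ρ)) {e : Γ.Elements}
    {α : Cof e.1} (k : PartialPt K e.1 α)
    (hk : ∀ {c : Cubeᵒᵖ} (f : e.1 ⟶ c) (hf : α.Holds f), ρ.app c (k.val f hf) = Γ.map f e.2) :
    PartialElt X e α where
  val {d} v hv := X.map (X := ⟨d.1, ρ.app d.1 (k.val v.1 hv)⟩) (Y := d)
    ⟨𝟙 d.1, (typeFunctor_map_id Γ _).trans ((hk v.1 hv).trans v.2)⟩ (τ.1 ⟨d.1, k.val v.1 hv⟩)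
  nat {d d'} v hv w := by
    have hτ := τ.2 (j := ⟨d.1, k.val v.1 hv⟩) (j' := ⟨d'.1, k.val (v ≫ w).1 (hv.comp w.1)⟩)
      ⟨w.1, k.nat v.1 hv w.1⟩
    rw [← hτ]
    refine (Functor.map_comp_apply X _ _ _).symm.trans
      (Eq.trans ?_ (Functor.map_comp_apply X _ _ _))
    congr 2
    apply congrArg
    apply Subtype.ext
    show 𝟙 d.1 ≫ w.1 = w.1 ≫ 𝟙 d'.1
    rw [Category.id_comp, Category.comp_id]


/-- The partial element `(k, i)` of `K × 𝕀`, for a partial element `k` of `K` and a total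
point `i`. -/
def PartialPt.pairI {K : CSet.{u}} {c : Cubeᵒᵖ} {α : Cof c} (k : PartialPt K c α) (i : II.obj c) :
    PartialPt (ctxI K) c α where
  val f hf := (k.val f hf, II.map f i)
  nat f hf g := Prod.ext (k.nat f hf g) (by exact (Functor.map_comp_apply II f g i).symm)

/-- The partial element `(γ, x)` of the total space, for a partial element `x` of `X γ`. -/
def PartialElt.toPt {X : Fam Γ} {d : Γ.Elements} {α : Cof d.1} (x : PartialElt X d α) :
    PartialPt X.extend d.1 α where
  val {c'} f hf := ⟨Γ.map f d.2, x.val (d' := ⟨c', Γ.map f d.2⟩) ⟨f, rfl⟩ hf⟩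
  nat {c' c''} f hf g :=
    X.extend_map_eq g _ _ _ _ (Functor.map_comp_apply Γ f g d.2).symm
      (x.nat (d' := ⟨c', Γ.map f d.2⟩) (d'' := ⟨c'', Γ.map (f ≫ g) d.2⟩) ⟨f, rfl⟩ hf
        ⟨g, (Functor.map_comp_apply Γ f g d.2).symm⟩)

theorem PartialElt.toPt_val {X : Fam Γ} {d d' : Γ.Elements} {α : Cof d.1} (x : PartialElt X d α)
    (v : d ⟶ d') (hv : α.Holds v.1) : x.toPt.val v.1 hv = ⟨d'.2, x.val v hv⟩ := by
  obtain ⟨c', γ⟩ := d'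
  obtain ⟨f, h⟩ := v
  change d.1 ⟶ c' at f
  change Γ.map f d.2 = γ at h
  subst h
  rfl

theorem PartialElt.toPt_res_val {X : Fam Γ} {d d' : Γ.Elements} {α : Cof d.1}
    (x : PartialElt X d α) (w : d ⟶ d') {c : Cubeᵒᵖ} (f : d'.1 ⟶ c) (hf : α.Holds (w.1 ≫ f)) :
    (x.res w).toPt.val f hf = x.toPt.val (w.1 ≫ f) hf :=
  (x.toPt_val (d' := ⟨c, Γ.map f d'.2⟩) (w ≫ ⟨f, rfl⟩) hf).symm

theorem PartialPt.lift_val_of_eq {K : CSet.{u}} {ρ : K ⟶ Γ} {X : Fam Γ} (τ : Tm (X.sub ρ))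
    {e : Γ.Elements} {α : Cof e.1} (k : PartialPt K e.1 α)
    (hk : ∀ {c : Cubeᵒᵖ} (f : e.1 ⟶ c) (hf : α.Holds f), ρ.app c (k.val f hf) = Γ.map f e.2)
    {d : Γ.Elements} (v : e ⟶ d) (hv : α.Holds v.1) (z : K.obj d.1) (hz : k.val v.1 hv = z) :
    (k.lift τ hk).val v hv = X.map (X := ⟨d.1, ρ.app d.1 z⟩) (Y := d)
      ⟨𝟙 d.1, (typeFunctor_map_id Γ _).trans
        ((congrArg (ρ.app d.1) hz.symm).trans ((hk v.1 hv).trans v.2))⟩ (τ.1 ⟨d.1, z⟩) := by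
  subst hz
  rfl

theorem PartialPt.lift_res {K : CSet.{u}} {ρ : K ⟶ Γ} {X : Fam Γ} (τ : Tm (X.sub ρ))
    {e e' : Γ.Elements} (w : e ⟶ e') {α : Cof e.1} (k : PartialPt K e.1 α)
    (hk : ∀ {c : Cubeᵒᵖ} (f : e.1 ⟶ c) (hf : α.Holds f), ρ.app c (k.val f hf) = Γ.map f e.2)
    (k' : PartialPt K e'.1 (α.res w.1))
    (hk' : ∀ {c : Cubeᵒᵖ} (f : e'.1 ⟶ c) (hf : (α.res w.1).Holds f),
      ρ.app c (k'.val f hf) = Γ.map f e'.2)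
    (h : ∀ {c : Cubeᵒᵖ} (f : e'.1 ⟶ c) (hf : (α.res w.1).Holds f),
      k'.val f hf = k.val (w.1 ≫ f) hf) :
    (k.lift τ hk).res w = k'.lift τ hk' := by
  apply PartialElt.ext
  funext d v hv
  exact PartialPt.lift_val_of_eq τ k hk (w ≫ v) hv _ (h v.1 hv).symm

end Extension

/-! ### Elements of dependent sums -/

namespace Fam

variable {Γ : CSet.{u}} {X : Fam Γ} {Y : Fam X.extend}

/-- The element `(x, y)` of `(x : X γ) × Y (γ, x)`, over the first projection of `p = (γ, x)`. -/
def sigmaMk (p : X.extend.Elements) (y : Y.obj p) :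
    (X.sigma Y).obj ((CategoryOfElements.map X.proj).obj p) := ⟨p.2.2, y⟩

theorem map_sigmaMk {p p' : X.extend.Elements} (v : p ⟶ p') (y : Y.obj p) :
    (X.sigma Y).map ((CategoryOfElements.map X.proj).map v) (sigmaMk p y) =
      sigmaMk p' (Y.map v y) := by
  obtain ⟨c', z'⟩ := p'
  obtain ⟨f, h⟩ := v
  change p.1 ⟶ c' at f
  change X.extend.map f p.2 = z' at h
  subst h
  rfl

/-- The global element of a family of dependent sums with components the second component of
`ω δ` and `y δ`. -/
def sigmaTm {Δ : CSet.{u}} (ω : Δ ⟶ X.extend) (y : Tm (Y.sub ω)) :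
    Tm ((X.sigma Y).sub (ω ≫ X.proj)) :=
  ⟨fun d => sigmaMk ((CategoryOfElements.map ω).obj d) (y.1 d), fun {d _} v =>
    (map_sigmaMk ((CategoryOfElements.map ω).map v) (y.1 d)).trans (congrArg _ (y.2 v))⟩

end Fam

/-! ### Weak composition from weak coercion -/

namespace DepPseudoReflGraph

variable {G : PseudoReflGraph.{u}} (D : DepPseudoReflGraph G) (W : G.WeakCoercion)

/-- The context of `a : 𝕀 → V`, `r : 𝕀`, `b : B (a r)`: the bases of composition problems. -/
abbrev BaseCtx : CSet.{u} := (D.B.sub (ev G.V)).extend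

/-- The map `(a, b, r) ↦ (a, r, b r)`. -/
def toBase : ctxI D.LineCtx ⟶ D.BaseCtx where
  app _ := TypeCat.ofHom fun z => ⟨(z.1.1, z.2), D.lineApp z.1 z.2⟩
  naturality c c' f := by
    refine ConcreteCategory.hom_ext _ _ fun z => ?_
    exact (Fam.extend_map_eq (D.B.sub (ev G.V)) f (z.1.1, z.2)
      (D.lineApp z.1 z.2) _ _ rfl (D.map_lineApp f z.1 z.2)).symm

/-- The map `(a, r, b, s) ↦ (a r, a s, wcoe a r s, b)`. -/
def edgeSrc : ctxI D.BaseCtx ⟶ G.EdgeSrcCtx D.B where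
  app c := TypeCat.ofHom fun z =>
    ⟨⟨(Line.app z.1.1.1 z.1.1.2, Line.app z.1.1.1 z.2),
      W.wcoe.1 ⟨c, ((z.1.1.1, z.1.1.2), z.2)⟩⟩, z.1.2⟩
  naturality c c' f := by
    refine ConcreteCategory.hom_ext _ _ fun z => ?_
    symm
    refine Fam.extend_map_eq (D.B.sub G.src) f _ _ _ _
        (Fam.extend_map_eq G.E f _ _ _ _
          (Prod.ext (Line.map_app z.1.1.1 f z.1.1.2) (Line.map_app z.1.1.1 f z.2)) ?_) ?_
    · exact W.wcoe.2 (j := ⟨c, ((z.1.1.1, z.1.1.2), z.2)⟩)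
        (j' := ⟨c', ((Line.res f z.1.1.1, II.map f z.1.1.2), II.map f z.2)⟩) ⟨f, rfl⟩
    · rfl

theorem map_edgeSrc {c c' : Cubeᵒᵖ} (f : c ⟶ c') (z : D.BaseCtx.obj c) (s : II.obj c) :
    (D.edgeSrc W).app c' (D.BaseCtx.map f z, II.map f s) =
      (G.EdgeSrcCtx D.B).map f ((D.edgeSrc W).app c (z, s)) :=
  NatTrans.naturality_apply (D.edgeSrc W) f (by exact (z, s))

/-- The map `(a, r, b) ↦ (a r, wcoe a r r, wcoh a r, b)`. -/
def loopBase : D.BaseCtx ⟶ G.LoopCtx D.B where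
  app c := TypeCat.ofHom fun z =>
    ⟨⟨⟨Line.app z.1.1 z.1.2, W.wcoe.1 ⟨c, ((z.1.1, z.1.2), z.1.2)⟩⟩, W.wcoh.1 ⟨c, z.1⟩⟩, z.2⟩
  naturality c c' f := by
    refine ConcreteCategory.hom_ext _ _ fun z => ?_
    symm
    refine Fam.extend_map_eq (D.B.sub G.vertex) f _ _ _ _
        (Fam.extend_map_eq G.R f _ _ _ _
          (Fam.extend_map_eq (G.E.sub (diag G.V)) f _ _ _ _ (Line.map_app z.1.1 f z.1.2) ?_)
          ?_) ?_
    · exact W.wcoe.2 (j := ⟨c, ((z.1.1, z.1.2), z.1.2)⟩)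
        (j' := ⟨c', ((Line.res f z.1.1, II.map f z.1.2), II.map f z.1.2)⟩) ⟨f, rfl⟩
    · exact W.wcoh.2 (j := ⟨c, z.1⟩)
        (j' := ⟨c', (Line.res f z.1.1, II.map f z.1.2)⟩) ⟨f, rfl⟩
    · rfl

/-- The family of the sets `(b₂ : B a₂) × E aₑ b₁ b₂`. -/
abbrev edgeFam : Fam (G.EdgeSrcCtx D.B) := (G.edgeTgt D.B).sigma D.E

/-- The family of the sets `(bₑ : E aₑ b b) × R aᵣ b bₑ`. -/
abbrev loopFam : Fam (G.LoopCtx D.B) := (D.E.sub (G.loopToEdge D.B)).sigma D.R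

/-- The element `(b, bₑ)` of `(b₂ : B a) × E aₑ b b₂`, for a reflexive loop `(bₑ, bᵣ)` at `b`. -/
def loopEdge {l : (G.LoopCtx D.B).Elements} (z : D.loopFam.obj l) :
    D.edgeFam.obj ((CategoryOfElements.map (G.loopToEdge D.B ≫ (G.edgeTgt D.B).proj)).obj l) :=
  Fam.sigmaMk ((CategoryOfElements.map (G.loopToEdge D.B)).obj l) z.1

theorem map_loopEdge {l l' : (G.LoopCtx D.B).Elements} (v : l ⟶ l') (z : D.loopFam.obj l) :
    D.edgeFam.map ((CategoryOfElements.map (G.loopToEdge D.B ≫ (G.edgeTgt D.B).proj)).map v)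
      (D.loopEdge z) = D.loopEdge (D.loopFam.map v z) :=
  Fam.map_sigmaMk ((CategoryOfElements.map (G.loopToEdge D.B)).map v) z.1

variable {W} (wB : D.WeakCoercion W)
variable {d : (pathObj G.V).Elements} {r : II.obj d.1} (S : ComInput (D.B.sub (ev G.V)) d r)

/-- The base of a composition problem with its context, `(a, r, b)`. -/
def base : D.BaseCtx.obj d.1 := ⟨(d.2, r), S.b⟩

theorem map_base {d' : (pathObj G.V).Elements} (w : d ⟶ d') :
    D.BaseCtx.map w.1 (D.base S) = D.base (S.res w) :=
  Fam.extend_map_eq (D.B.sub (ev G.V)) w.1 _ _ _ _ (pairIHom w r).2 rfl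

/-- Under `α`, the value of the tube `t` at `r` is the base `b`. -/
theorem toBase_tube {c : Cubeᵒᵖ} (f : d.1 ⟶ c) (hf : S.cof.Holds f) :
    D.toBase.app c ((S.t.toPt.pairI r).val f hf) = D.BaseCtx.map f (D.base S) := by
  symm
  refine Fam.extend_map_eq (D.B.sub (ev G.V)) f _ _ _ _ rfl ?_
  exact (S.compat (d' := ⟨c, (pathObj G.V).map f d.2⟩) ⟨f, rfl⟩ hf).symm

variable (W) in
/-- The element `(a r, a s, wcoe a r s, b)` given by a composition problem and `s`. -/
abbrev edgeElt (s : II.obj d.1) : (G.EdgeSrcCtx D.B).Elements :=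
  ⟨d.1, (D.edgeSrc W).app d.1 (D.base S, s)⟩

variable (W) in
/-- `edgeElt` is stable under restriction. -/
def edgeHom (s : II.obj d.1) {d' : (pathObj G.V).Elements} (w : d ⟶ d') :
    D.edgeElt W S s ⟶ D.edgeElt W (S.res w) (II.map w.1 s) :=
  ⟨w.1, (D.map_edgeSrc W w.1 (D.base S) s).symm.trans
    (congrArg (fun z => (D.edgeSrc W).app d'.1 (z, II.map w.1 s)) (D.map_base S w))⟩

variable (W) in
/-- The element `(a r, wcoe a r r, wcoh a r, b)` given by a composition problem. -/
abbrev loopElt : (G.LoopCtx D.B).Elements := ⟨d.1, (D.loopBase W).app d.1 (D.base S)⟩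

variable (W) in
/-- `loopElt` is stable under restriction. -/
def loopHom {d' : (pathObj G.V).Elements} (w : d ⟶ d') :
    D.loopElt W S ⟶ D.loopElt W (S.res w) :=
  ⟨w.1, ((D.loopBase W).naturality_apply w.1 (D.base S)).symm.trans
    (congrArg (fun z => (D.loopBase W).app d'.1 z) (D.map_base S w))⟩

theorem edgeTube_base (s : II.obj d.1) {c : Cubeᵒᵖ} (f : d.1 ⟶ c) (hf : S.cof.Holds f) :
    (D.wcoeCtx W ≫ (G.edgeTgt D.B).proj).app c (((S.t.toPt.pairI r).pairI s).val f hf) =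
      (G.EdgeSrcCtx D.B).map f (D.edgeElt W S s).2 :=
  (congrArg (fun z => (D.edgeSrc W).app c (z, II.map f s)) (D.toBase_tube S f hf)).trans
    (D.map_edgeSrc W f (D.base S) s)

theorem loopTube_base {c : Cubeᵒᵖ} (f : d.1 ⟶ c) (hf : S.cof.Holds f) :
    (D.wcohCtx W wB.wcoe ≫ (D.E.sub (G.loopToEdge D.B)).proj).app c
      ((S.t.toPt.pairI r).val f hf) = (G.LoopCtx D.B).map f (D.loopElt W S).2 :=
  (congrArg (fun z => (D.loopBase W).app c z) (D.toBase_tube S f hf)).trans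
    ((D.loopBase W).naturality_apply f (D.base S))

/-- The partial element `(t s, wcoe t r s)` of `(b₂ : B (a s)) × E (wcoe a r s) b b₂`; it is
well typed because `t r = b` under `α`. -/
def edgeTube (s : II.obj d.1) : PartialElt D.edgeFam (D.edgeElt W S s) S.cof :=
  PartialPt.lift (Fam.sigmaTm (D.wcoeCtx W) wB.wcoe) ((S.t.toPt.pairI r).pairI s)
    (D.edgeTube_base S s)

/-- The partial element `(wcoe t r r, wcoh t r)` of
`(bₑ : E (wcoe a r r) b b) × R (wcoh a r) b bₑ`. -/
def loopTube : PartialElt D.loopFam (D.loopElt W S) S.cof :=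
  PartialPt.lift (Fam.sigmaTm (D.wcohCtx W wB.wcoe) wB.wcoh) (S.t.toPt.pairI r)
    (D.loopTube_base wB S)

theorem tube_res {d' : (pathObj G.V).Elements} (w : d ⟶ d') {c : Cubeᵒᵖ} (f : d'.1 ⟶ c)
    (hf : (S.cof.res w.1).Holds f) :
    ((S.res w).t.toPt.pairI (II.map w.1 r)).val f hf = (S.t.toPt.pairI r).val (w.1 ≫ f) hf :=
  Prod.ext (S.t.toPt_res_val w f hf) (by exact (Functor.map_comp_apply II w.1 f r).symm)

theorem edgeTube_res (s : II.obj d.1) {d' : (pathObj G.V).Elements} (w : d ⟶ d') :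
    (D.edgeTube wB S s).res (D.edgeHom W S s w) = D.edgeTube wB (S.res w) (II.map w.1 s) :=
  PartialPt.lift_res (Fam.sigmaTm (D.wcoeCtx W) wB.wcoe) (D.edgeHom W S s w)
    ((S.t.toPt.pairI r).pairI s) (D.edgeTube_base S s)
    (((S.res w).t.toPt.pairI (II.map w.1 r)).pairI (II.map w.1 s))
    (D.edgeTube_base (S.res w) (II.map w.1 s))
    fun f hf => Prod.ext (D.tube_res S w f hf) (by exact (Functor.map_comp_apply II w.1 f s).symm)

theorem loopTube_res {d' : (pathObj G.V).Elements} (w : d ⟶ d') :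
    (D.loopTube wB S).res (D.loopHom W S w) = D.loopTube wB (S.res w) :=
  PartialPt.lift_res (Fam.sigmaTm (D.wcohCtx W wB.wcoe) wB.wcoh) (D.loopHom W S w)
    (S.t.toPt.pairI r) (D.loopTube_base wB S) ((S.res w).t.toPt.pairI (II.map w.1 r))
    (D.loopTube_base wB (S.res w)) (D.tube_res S w)

theorem edgeTube_val_fst (s : II.obj d.1) {d' : (pathObj G.V).Elements} (w : d ⟶ d')
    (hw : S.cof.Holds w.1) :
    ((D.edgeTube wB S s).val (D.edgeHom W S s w) hw).1 =
      (S.t.val w hw).app (II.map w.1 s) := by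
  have hz : ((S.t.toPt.pairI r).pairI s).val w.1 hw =
      ((⟨d'.2, S.t.val w hw⟩, II.map w.1 r), II.map w.1 s) := by
    show ((S.t.toPt.val w.1 hw, _), _) = _
    rw [S.t.toPt_val w hw]
  have h := PartialPt.lift_val_of_eq (Fam.sigmaTm (D.wcoeCtx W) wB.wcoe)
    ((S.t.toPt.pairI r).pairI s) (D.edgeTube_base S s) (D.edgeHom W S s w) hw _ hz
  refine (congrArg Sigma.fst h).trans ?_
  exact typeFunctor_map_id D.B (X := ⟨d'.1, Line.app d'.2 (II.map w.1 s)⟩) _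

/-- If `(bₑ, bᵣ)` extends `(wcoe t r r, wcoh t r)`, then `(b, bₑ)` extends `(t r, wcoe t r r)`. -/
theorem loopEdge_loopTube {e : (G.EdgeSrcCtx D.B).Elements} (v : D.edgeElt W S r ⟶ e)
    (hv : S.cof.Holds v.1) (z : D.loopFam.obj (D.loopElt W S))
    (hz : ∀ {l : (G.LoopCtx D.B).Elements} (w : D.loopElt W S ⟶ l) (hw : S.cof.Holds w.1),
      D.loopFam.map w z = (D.loopTube wB S).val w hw) :
    D.edgeFam.map v (D.loopEdge z) = (D.edgeTube wB S r).val v hv := by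
  obtain ⟨c, γ⟩ := e
  obtain ⟨f, h⟩ := v
  change d.1 ⟶ c at f
  change (G.EdgeSrcCtx D.B).map f _ = γ at h
  subst h
  -- Every restriction of `edgeElt` at `s = r` comes from a restriction of `loopElt`.
  let l : (G.LoopCtx D.B).Elements := ⟨c, (G.LoopCtx D.B).map f (D.loopElt W S).2⟩
  let w : D.loopElt W S ⟶ l := ⟨f, rfl⟩
  refine (D.map_loopEdge w z).trans ((congrArg D.loopEdge (hz w hv)).trans ?_)
  exact (D.map_loopEdge _ _).symm

variable (T : ExtOp D.edgeFam) (T' : ExtOp D.loopFam)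

/-- Two extensions of `(t r, wcoe t r r)`: the one chosen for the edges from `b`, whose first
component is `wcom r r`, and the pair of `b` and a total loop `bₑ` at `b`. -/
def pathProblem : PathProblem D.edgeFam (D.edgeElt W S r) S.cof where
  x := D.edgeTube wB S r
  x₀ := T.total (e := D.edgeElt W S r) S.cof (D.edgeTube wB S r)
  x₁ := D.loopEdge (T'.total (e := D.loopElt W S) S.cof (D.loopTube wB S))
  left v hv := T.map_total _ _ v hv
  right v hv := D.loopEdge_loopTube wB S v hv _ fun w hw => T'.map_total _ _ w hw

theorem map_total_edgeTube (s : II.obj d.1) {d' : (pathObj G.V).Elements} (w : d ⟶ d') :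
    D.edgeFam.map (D.edgeHom W S s w) (T.total S.cof (D.edgeTube wB S s)) =
      T.total (S.res w).cof (D.edgeTube wB (S.res w) (II.map w.1 s)) :=
  (T.total_nat _ _ _).trans (congrArg
    (T.total (e := D.edgeElt W (S.res w) (II.map w.1 s)) (S.res w).cof)
    (D.edgeTube_res wB S s w))

theorem map_fill_pathProblem (i : II.obj d.1) {d' : (pathObj G.V).Elements} (w : d ⟶ d') :
    D.edgeFam.map (D.edgeHom W S r w) ((D.pathProblem wB S T T').fill i T) =
      (D.pathProblem wB (S.res w) T T').fill (II.map w.1 i) T :=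
  ((D.pathProblem wB S T T').map_fill i T (D.edgeHom W S r w)).trans
    (PathProblem.fill_congr _ T (D.edgeTube_res wB S r w) (D.map_total_edgeTube wB S T r w)
      ((D.map_loopEdge (D.loopHom W S w) _).trans (congrArg D.loopEdge
        ((T'.total_nat _ _ _).trans
          (congrArg (T'.total (e := D.loopElt W (S.res w)) (S.res w).cof)
            (D.loopTube_res wB S w))))))

/-- The weak composition structure on `i ↦ B (a i)`: `wcom r s` is the first component of the
extension of `(t s, wcoe t r s)`, and the path from `wcom r r` to `b` is the first component of the
path joining the two extensions in `pathProblem`. -/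
noncomputable def wcomAt (e : (pathObj G.V).Elements) : WComAt (D.B.sub (ev G.V)) e where
  wcom _ _ s S := (T.total (e := D.edgeElt W S s) S.cof (D.edgeTube wB S s)).1
  wcom_extends _ _ s S _ w hw :=
    (congrArg Sigma.fst (T.map_total (e := D.edgeElt W S s) S.cof (D.edgeTube wB S s)
      (D.edgeHom W S s w) hw)).trans (D.edgeTube_val_fst wB S s w hw)
  wcom_nat _ _ s S w := congrArg Sigma.fst (D.map_total_edgeTube wB S T s w)
  path _ _ S i := ((D.pathProblem wB S T T').fill i T).1
  path_zero _ _ S := congrArg Sigma.fst ((D.pathProblem wB S T T').fill_zero T)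
  path_one _ _ S := congrArg Sigma.fst ((D.pathProblem wB S T T').fill_one T)
  path_extends _ r S i _ w hw :=
    (congrArg Sigma.fst ((D.pathProblem wB S T T').map_fill_of_holds i T
      (D.edgeHom W S r w) hw)).trans ((D.edgeTube_val_fst wB S r w hw).trans (S.compat w hw))
  path_nat _ _ S i w := congrArg Sigma.fst (D.map_fill_pathProblem wB S T T' i w)

end DepPseudoReflGraph

/-! ### Fibrancy -/

/-- The transpose, along the right adjoint of `(-)^𝕀`, of a global element over `A^𝕀`: its element
at `a : y(J) ⟶ A` is the restriction along `a^𝕀`. -/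
def tinyTranspose {A : CSet.{u}} {C : Fam (pathObj A)} (t : Tm C) : Tm (tinyRight C) :=
  ⟨fun _ => ⟨fun {p} _ => t.1 p, fun _ v => t.2 v⟩, fun _ => rfl⟩

theorem lemma2 (G : PseudoReflGraph.{u}) (D : DepPseudoReflGraph G)
    (wA : G.WeakCoercion) (wB : D.WeakCoercion wA) (hB : D.IsHomotopical) :
    IsFibrantFamily D.B := by
  obtain ⟨T⟩ := hB.edge.nonempty_extOp
  obtain ⟨T'⟩ := hB.loop.nonempty_extOp
  exact ⟨tinyTranspose ⟨fun e => D.wcomAt wB T T' e, fun _ => rfl⟩⟩
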